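/- Let $\mathbb{H}$ be a complex Hilbert space with scalar product $h_0$ (linear in the second argument), and let $T$ be an automorphism of $\mathbb{H}$ (a bounded linear bijection with bounded inverse) that is uniformly bounded, i.e. there is $c<\infty$ with $\|T^k\|<c$ for all $k\in\mathbb{Z}$. Let $\mathrm{Lim}$ be a Banach limit, i.e. a positive, normalized, shift-invariant linear functional on the bounded complex sequences $(\xi_n)_{n\ge 0}$, and let $$h_T(x,y)=\mathrm{Lim}_{n\to\infty}\,h_0(T^n x,T^n y)$$ be the corresponding Nagy product, a Hermitian scalar product on $\mathbb{H}$ that is invariant under $T$. Then there exists a bounded operator $A$ on $\mathbb{H}$, defined everywhere and self-adjoint with respect to $h_T$, i.e. $h_T(Ax,y)=h_T(x,Ay)$ for all $x,y\in\mathbb{H}$, such that $$T^n=e^{iAn}\qquad\text{for every } n\in\mathbb{Z}.$$ Moreover $t\mapsto e^{iAt}$, $t\in\mathbb{R}$, is a norm-continuous one-parameter group of $h_T$-unitary operators (so it contains the discrete group $\{T^n\}_{n\in\mathbb{Z}}$), and for every $\psi\in\mathbb{H}$ the orbit $t\mapsto e^{iAt}\psi$ is differentiable and satisfies $\frac{d}{dt}e^{iAt}\psi=iA\,e^{iAt}\psi$.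 -/

import Mathlib

open Filter Topology
open scoped ComplexOrder ComplexConjugate BoundedContinuousFunction

noncomputable section

/-- The shift `(ξ₀, ξ₁, ξ₂, …) ↦ (ξ₁, ξ₂, ξ₃, …)` on bounded complex sequences. -/
def shiftSeq (x : ℕ →ᵇ ℂ) : ℕ →ᵇ ℂ :=
  x.compContinuous ⟨Nat.succ, continuous_of_discreteTopology⟩

/-- A Banach (Banach–Mazur generalized) limit on bounded complex sequences: a linear functional
that is positive, normalized and shift invariant. (`0 ≤ z` in `ℂ` means that `z` is real and
nonnegative.) -/
structure BanachLimit extends (ℕ →ᵇ ℂ) →ₗ[ℂ] ℂ where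
  nonneg' : ∀ x : ℕ →ᵇ ℂ, (∀ n, 0 ≤ x n) → 0 ≤ toFun x
  map_one' : toFun 1 = 1
  map_shift' : ∀ x : ℕ →ᵇ ℂ, toFun (shiftSeq x) = toFun x

/-- The value `Lim x` of a Banach limit on a bounded sequence. -/
def BanachLimit.lim (L : BanachLimit) (x : ℕ →ᵇ ℂ) : ℂ := L.toLinearMap x

namespace BanachLimit

/-- Cesàro means. -/
def cesaro (x : ℕ → ℂ) (n : ℕ) : ℂ := ((n : ℂ) + 1)⁻¹ * ∑ k ∈ Finset.range (n + 1), x k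

theorem norm_cesaro_le (x : ℕ →ᵇ ℂ) (n : ℕ) : ‖cesaro x n‖ ≤ ‖x‖ := by
  have h1 : ‖∑ k ∈ Finset.range (n + 1), x k‖ ≤ (n + 1 : ℝ) * ‖x‖ := by
    refine (norm_sum_le _ _).trans ?_
    refine (Finset.sum_le_card_nsmul _ _ ‖x‖ (fun k _ => x.norm_coe_le_norm k)).trans ?_
    simp
  have h2 : ‖((n : ℂ) + 1)‖ = (n + 1 : ℝ) := by
    have : ((n : ℂ) + 1) = ((n + 1 : ℝ) : ℂ) := by push_cast; rfl
    rw [this, Complex.norm_real, Real.norm_of_nonneg (by positivity)]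
  have h3 : (0 : ℝ) < n + 1 := by positivity
  rw [cesaro, norm_mul, norm_inv, h2]
  calc (n + 1 : ℝ)⁻¹ * _ ≤ (n + 1 : ℝ)⁻¹ * ((n + 1 : ℝ) * ‖x‖) := by gcongr
    _ = ‖x‖ := by field_simp

theorem exists_tendsto_cesaro (x : ℕ →ᵇ ℂ) :
    ∃ a : ℂ, Tendsto (cesaro x) (hyperfilter ℕ : Filter ℕ) (𝓝 a) := by
  have hc : IsCompact (Metric.closedBall (0 : ℂ) ‖x‖) := isCompact_closedBall _ _
  have hm : ∀ n, cesaro x n ∈ Metric.closedBall (0 : ℂ) ‖x‖ := fun n => by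
    simpa using norm_cesaro_le x n
  obtain ⟨a, -, ha⟩ := hc.ultrafilter_le_nhds ((hyperfilter ℕ).map (cesaro x)) (by
    rw [le_principal_iff]
    exact Filter.Eventually.of_forall (f := (hyperfilter ℕ : Filter ℕ)) hm)
  exact ⟨a, ha⟩

/-- Banach limits exist. -/
instance instNonempty : Nonempty BanachLimit := by
  choose f hf using exists_tendsto_cesaro
  refine ⟨{ toFun := f, map_add' := ?_, map_smul' := ?_, nonneg' := ?_, map_one' := ?_,
            map_shift' := ?_ }⟩
  · intro x y
    refine tendsto_nhds_unique (hf (x + y)) (((hf x).add (hf y)).congr (fun n => ?_))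
    simp [cesaro, Finset.sum_add_distrib, mul_add]
  · intro c x
    refine tendsto_nhds_unique (hf (c • x)) (((hf x).const_mul c).congr (fun n => ?_))
    simp only [cesaro, BoundedContinuousFunction.coe_smul, smul_eq_mul, ← Finset.mul_sum]
    ring
  · intro x hx
    refine ge_of_tendsto' (hf x) (fun n => ?_)
    have h1 : (0 : ℂ) ≤ ((n : ℂ) + 1)⁻¹ := by
      have : ((n : ℂ) + 1)⁻¹ = (((n + 1 : ℝ)⁻¹ : ℝ) : ℂ) := by push_cast; rfl
      rw [this]
      exact Complex.zero_le_real.2 (by positivity)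
    exact mul_nonneg h1 (Finset.sum_nonneg (fun k _ => hx k))
  · refine tendsto_nhds_unique (hf 1) (tendsto_const_nhds.congr (fun n => ?_))
    have : ((n : ℂ) + 1) ≠ 0 := Nat.cast_add_one_ne_zero n
    simp [cesaro, this]
  · intro x
    have h0 : Tendsto (fun n : ℕ => cesaro (shiftSeq x) n - cesaro x n) atTop (𝓝 0) := by
      have hb : Tendsto (fun n : ℕ => (2 * ‖x‖) * (1 / ((n : ℝ) + 1))) atTop (𝓝 0) := by
        simpa using (tendsto_one_div_add_atTop_nhds_zero_nat (𝕜 := ℝ)).const_mul (2 * ‖x‖)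
      refine squeeze_zero_norm (fun n => ?_) hb
      have h2 : ‖((n : ℂ) + 1)‖ = (n + 1 : ℝ) := by
        have : ((n : ℂ) + 1) = ((n + 1 : ℝ) : ℂ) := by push_cast; rfl
        rw [this, Complex.norm_real, Real.norm_of_nonneg (by positivity)]
      have h3 : cesaro (shiftSeq x) n - cesaro x n = ((n : ℂ) + 1)⁻¹ * (x (n + 1) - x 0) := by
        rw [cesaro, cesaro, ← mul_sub, ← Finset.sum_sub_distrib]
        congr 1
        exact Finset.sum_range_sub (fun k => x k) (n + 1)
      rw [h3, norm_mul, norm_inv, h2, mul_comm, one_div]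
      have h4 : ‖x (n + 1) - x 0‖ ≤ 2 * ‖x‖ := by
        refine (norm_sub_le _ _).trans ?_
        linarith [x.norm_coe_le_norm (n + 1), x.norm_coe_le_norm 0]
      gcongr
    have h1 := h0.mono_left (Nat.hyperfilter_le_atTop)
    have h2 := tendsto_nhds_unique h1 ((hf (shiftSeq x)).sub (hf x))
    exact (sub_eq_zero.1 h2.symm)

variable (L : BanachLimit)

theorem lim_add (x y : ℕ →ᵇ ℂ) : L.lim (x + y) = L.lim x + L.lim y := map_add L.toLinearMap x y

theorem lim_sub (x y : ℕ →ᵇ ℂ) : L.lim (x - y) = L.lim x - L.lim y := map_sub L.toLinearMap x y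

theorem lim_smul (c : ℂ) (x : ℕ →ᵇ ℂ) : L.lim (c • x) = c * L.lim x :=
  map_smul L.toLinearMap c x

theorem lim_nonneg (x : ℕ →ᵇ ℂ) (hx : ∀ n, 0 ≤ x n) : 0 ≤ L.lim x := L.nonneg' x hx

theorem lim_one : L.lim 1 = 1 := L.map_one'

theorem lim_shift (x : ℕ →ᵇ ℂ) : L.lim (shiftSeq x) = L.lim x := L.map_shift' x

theorem lim_const (c : ℂ) : L.lim (c • (1 : ℕ →ᵇ ℂ)) = c := by rw [lim_smul, lim_one, mul_one]

theorem lim_mono (x y : ℕ →ᵇ ℂ) (h : ∀ n, x n ≤ y n) : L.lim x ≤ L.lim y := by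
  have := L.lim_nonneg (y - x) (fun n => by simpa using h n)
  rw [lim_sub] at this
  exact sub_nonneg.1 this

theorem conj_lim_of_real (x : ℕ →ᵇ ℂ) (hx : ∀ n, conj (x n) = x n) :
    conj (L.lim x) = L.lim x := by
  have h1 : 0 ≤ L.lim (x + (‖x‖ : ℂ) • (1 : ℕ →ᵇ ℂ)) := by
    refine L.lim_nonneg _ (fun n => ?_)
    obtain ⟨r, hr⟩ := Complex.conj_eq_iff_real.1 (hx n)
    have h2 : |r| ≤ ‖x‖ := by
      have := x.norm_coe_le_norm n
      rwa [hr, Complex.norm_real, Real.norm_eq_abs] at this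
    have h3 : (x + (‖x‖ : ℂ) • (1 : ℕ →ᵇ ℂ)) n = ((r + ‖x‖ : ℝ) : ℂ) := by simp [hr]
    rw [h3]
    exact Complex.zero_le_real.2 (by linarith [neg_abs_le r])
  rw [lim_add, lim_const] at h1
  have h4 := Complex.conj_eq_iff_im.2 (Complex.nonneg_iff.1 h1).2.symm
  rw [map_add, Complex.conj_ofReal] at h4
  exact add_right_cancel h4

theorem lim_conj (x y : ℕ →ᵇ ℂ) (h : ∀ n, y n = conj (x n)) : L.lim y = conj (L.lim x) := by
  have h1 := L.conj_lim_of_real (x + y) (fun n => by simp [h, add_comm])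
  have h2 := L.conj_lim_of_real (Complex.I • (x - y)) (fun n => by simp [h]; ring)
  rw [lim_add, map_add] at h1
  rw [lim_smul, lim_sub, map_mul, Complex.conj_I, map_sub] at h2
  have h3 : conj (L.lim x) - conj (L.lim y) = -(L.lim x - L.lim y) := by
    have := congrArg (fun z => Complex.I * z) h2
    simp only [← mul_assoc, mul_neg, neg_mul, Complex.I_mul_I] at this
    linear_combination this
  linear_combination (-1 / 2 : ℂ) * h1 - (1 / 2 : ℂ) * h3

end BanachLimit

section Nagy

variable {H : Type*} [NormedAddCommGroup H] [InnerProductSpace ℂ H]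

/-- An automorphism `T` of `H` (bounded, with bounded inverse) is uniformly bounded if
`‖T ^ k‖ < c` for some finite `c` and all `k ∈ ℤ`. -/
def UniformlyBounded (T : H ≃L[ℂ] H) : Prop :=
  ∃ c : ℝ, ∀ k : ℤ, ‖((T ^ k : H ≃L[ℂ] H) : H →L[ℂ] H)‖ < c

theorem UniformlyBounded.exists_norm_apply_le {T : H ≃L[ℂ] H} (hT : UniformlyBounded T) :
    ∃ c : ℝ, 0 < c ∧ ∀ (k : ℤ) (x : H), ‖(T ^ k) x‖ ≤ c * ‖x‖ := by
  obtain ⟨c, hc⟩ := hT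
  refine ⟨c, (norm_nonneg _).trans_lt (hc 0), fun k x => ?_⟩
  exact ContinuousLinearMap.le_of_opNorm_le ((T ^ k : H ≃L[ℂ] H) : H →L[ℂ] H) (hc k).le x

theorem UniformlyBounded.exists_norm_inner_le {T : H ≃L[ℂ] H} (hT : UniformlyBounded T)
    (x y : H) : ∃ C : ℝ, ∀ n : ℕ, ‖inner ℂ ((T ^ n) x) ((T ^ n) y)‖ ≤ C := by
  obtain ⟨c, hc, h⟩ := hT.exists_norm_apply_le
  refine ⟨(c * ‖x‖) * (c * ‖y‖), fun n => (norm_inner_le_norm _ _).trans ?_⟩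
  have h1 := h n x
  have h2 := h n y
  rw [zpow_natCast] at h1 h2
  gcongr

/-- The bounded sequence `n ↦ h₀(Tⁿ x, Tⁿ y)`, `n = 0, 1, 2, …`, where `h₀` is the given inner
product of `H`. -/
def nagySeq (T : H ≃L[ℂ] H) (hT : UniformlyBounded T) (x y : H) : ℕ →ᵇ ℂ :=
  BoundedContinuousFunction.ofNormedAddCommGroupDiscrete
    (fun n : ℕ => inner ℂ ((T ^ n) x) ((T ^ n) y))
    (hT.exists_norm_inner_le x y).choose (hT.exists_norm_inner_le x y).choose_spec

theorem nagySeq_apply (T : H ≃L[ℂ] H) (hT : UniformlyBounded T) (x y : H) (n : ℕ) :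
    nagySeq T hT x y n = inner ℂ ((T ^ n) x) ((T ^ n) y) := rfl

theorem lim_nagySeq_self_ge (L : BanachLimit) (T : H ≃L[ℂ] H) (hT : UniformlyBounded T) :
    ∃ a : ℝ, 0 < a ∧ ∀ x : H, ((a * ‖x‖ ^ 2 : ℝ) : ℂ) ≤ L.lim (nagySeq T hT x x) := by
  obtain ⟨c, hc, h⟩ := hT.exists_norm_apply_le
  refine ⟨(c ^ 2)⁻¹, by positivity, fun x => ?_⟩
  rw [← L.lim_const (((c ^ 2)⁻¹ * ‖x‖ ^ 2 : ℝ) : ℂ)]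
  refine L.lim_mono _ _ (fun n => ?_)
  rw [nagySeq_apply, inner_self_eq_norm_sq_to_K]
  have h1 := h (-(n : ℤ)) ((T ^ (n : ℤ)) x)
  have h2 : (T ^ (-(n : ℤ))) ((T ^ (n : ℤ)) x) = x := by
    have h5 : T ^ (-(n : ℤ)) * T ^ (n : ℤ) = 1 := by rw [← zpow_add]; simp
    exact congrArg (fun S : H ≃L[ℂ] H => S x) h5
  rw [h2, zpow_natCast] at h1
  have h3 : (c ^ 2)⁻¹ * ‖x‖ ^ 2 ≤ ‖(T ^ n) x‖ ^ 2 := by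
    rw [inv_mul_le_iff₀ (by positivity), ← mul_pow]
    gcongr
  have h4 : ((((c ^ 2)⁻¹ * ‖x‖ ^ 2 : ℝ) : ℂ) • (1 : ℕ →ᵇ ℂ)) n
      = (((c ^ 2)⁻¹ * ‖x‖ ^ 2 : ℝ) : ℂ) := by simp
  rw [h4]
  have h5 := Complex.real_le_real.2 h3
  rwa [Complex.ofReal_pow] at h5

theorem lim_nagySeq_self_le (L : BanachLimit) (T : H ≃L[ℂ] H) (hT : UniformlyBounded T) :
    ∃ b : ℝ, 0 < b ∧ ∀ x : H, L.lim (nagySeq T hT x x) ≤ ((b * ‖x‖ ^ 2 : ℝ) : ℂ) := by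
  obtain ⟨c, hc, h⟩ := hT.exists_norm_apply_le
  refine ⟨c ^ 2, by positivity, fun x => ?_⟩
  rw [← L.lim_const ((c ^ 2 * ‖x‖ ^ 2 : ℝ) : ℂ)]
  refine L.lim_mono _ _ (fun n => ?_)
  rw [nagySeq_apply, inner_self_eq_norm_sq_to_K]
  have h1 := h n x
  rw [zpow_natCast] at h1
  have h3 : ‖(T ^ n) x‖ ^ 2 ≤ c ^ 2 * ‖x‖ ^ 2 := by
    rw [← mul_pow]
    gcongr
  have h4 : (((c ^ 2 * ‖x‖ ^ 2 : ℝ) : ℂ) • (1 : ℕ →ᵇ ℂ)) n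
      = ((c ^ 2 * ‖x‖ ^ 2 : ℝ) : ℂ) := by simp
  rw [h4]
  have h5 := Complex.real_le_real.2 h3
  rwa [Complex.ofReal_pow] at h5

/-- The Nagy product `h_T(x, y) = Lim_{n → ∞} h₀(Tⁿ x, Tⁿ y)` of a uniformly bounded
automorphism `T`, where `Lim` is the Banach limit `L`. -/
def nagyProduct (L : BanachLimit) (T : H ≃L[ℂ] H) (hT : UniformlyBounded T) (x y : H) : ℂ :=
  L.lim (nagySeq T hT x y)

/-- The Nagy product is a Hermitian scalar product (linear in the second argument). -/
@[reducible] def nagyProductCore (L : BanachLimit) (T : H ≃L[ℂ] H) (hT : UniformlyBounded T) :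
    InnerProductSpace.Core ℂ H where
  inner := nagyProduct L T hT
  conj_inner_symm x y := by
    refine (L.lim_conj _ _ (fun n => ?_)).symm
    simp only [nagySeq_apply, inner_conj_symm]
  re_inner_nonneg x := by
    refine (Complex.nonneg_iff.1 (L.lim_nonneg _ (fun n => ?_))).1
    rw [nagySeq_apply, inner_self_eq_norm_sq_to_K]
    have h5 := Complex.zero_le_real.2 (sq_nonneg ‖(T ^ n) x‖)
    rwa [Complex.ofReal_pow] at h5
  add_left x y z := by
    simp only [nagyProduct]
    rw [← L.lim_add]
    congr 1
    ext n
    simp only [BoundedContinuousFunction.coe_add, Pi.add_apply, nagySeq_apply, map_add,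
      inner_add_left]
  smul_left x y r := by
    simp only [nagyProduct]
    rw [← L.lim_smul]
    congr 1
    ext n
    simp only [BoundedContinuousFunction.coe_smul, smul_eq_mul, nagySeq_apply, map_smul,
      inner_smul_left]
  definite x hx := by
    obtain ⟨a, ha, h⟩ := lim_nagySeq_self_ge L T hT
    have h1 := h x
    rw [show L.lim (nagySeq T hT x x) = 0 from hx] at h1
    have h2 : a * ‖x‖ ^ 2 ≤ 0 := by exact_mod_cast h1
    have h3 : ‖x‖ ^ 2 ≤ 0 := by
      by_contra hcon
      push Not at hcon
      exact absurd h2 (not_le.2 (mul_pos ha hcon))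
    exact norm_eq_zero.1 (pow_eq_zero_iff two_ne_zero |>.1 (le_antisymm h3 (sq_nonneg _)))

/-- The operator `e^{iAt}` for a bounded operator `A` and a real time `t`. -/
def expI (A : H →L[ℂ] H) (t : ℝ) : H →L[ℂ] H :=
  NormedSpace.exp ((Complex.I * (t : ℂ)) • A)

end Nagy

end

/-! Uniform bounds on the positive and negative powers of `T` make the Nagy norm equivalent to the
original one, so the space stays complete, and shift invariance of the Banach limit makes `T`
unitary for `h_T`. Everything then reduces to a self-adjoint logarithm of a unitary `U`
(`exists_isSelfAdjoint_exp_eq`), transported back along the identity map.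

The spectrum of `U` may be the whole circle, where no continuous logarithm exists, so the continuous
functional calculus does not suffice. It does give `B = arccos (Re U)`, the angle up to sign:
`e^{iB}` agrees with `U` where `Im U ≥ 0`, and `e^{-iB}` where `Im U ≤ 0`. The sign is chosen by one
spectral projection `Q`, onto the kernel of the negative part of `Im U`, and `A = B(2Q - 1)`. -/

/-- For operators with `q` a projection: `x` and `y` agree on the range of `q`, which `y` preserves,
so all their powers agree there, hence so do the exponential series. -/
theorem exp_mul_eq_exp_mul_of_mul_eq {R : Type*} [NormedRing R] [NormedAlgebra ℂ R]
    [CompleteSpace R] {x y q : R} (h : x * q = y * q) (hc : Commute y q) :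
    NormedSpace.exp x * q = NormedSpace.exp y * q := by
  have hpow : ∀ n : ℕ, x ^ n * q = y ^ n * q := by
    intro n
    induction n with
    | zero => simp
    | succ n ih =>
      rw [pow_succ, mul_assoc, h, hc.eq, ← mul_assoc, ih, mul_assoc, ← hc.eq, ← mul_assoc,
        ← pow_succ]
  rw [NormedSpace.exp_eq_tsum ℂ]
  simp only
  rw [← (NormedSpace.expSeries_summable' (𝕂 := ℂ) x).tsum_mul_right,
    ← (NormedSpace.expSeries_summable' (𝕂 := ℂ) y).tsum_mul_right]
  simp only [smul_mul_assoc, hpow]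

/-! ### Self-adjoint logarithm of a unitary operator -/

section Hilbert

variable {K : Type*} [NormedAddCommGroup K] [InnerProductSpace ℂ K] [CompleteSpace K]

/-- Commuting with `N`, `B` preserves `ker N`, i.e. `QBQ = BQ`; the adjoint of this identity is `QBQ
= QB`. -/
theorem commute_starProjection_ker {B N : K →L[ℂ] K} (hB : IsSelfAdjoint B) (h : Commute B N) :
    Commute B N.ker.starProjection := by
  set Q : K →L[ℂ] K := N.ker.starProjection
  have hQ : IsSelfAdjoint Q := isSelfAdjoint_starProjection _
  have h1 : Q * (B * Q) = B * Q := by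
    ext x
    refine Submodule.starProjection_eq_self_iff.2 ?_
    have hx : N (Q x) = 0 := Submodule.starProjection_apply_mem N.ker x
    change N (B (Q x)) = 0
    have := congrArg (fun S : K →L[ℂ] K => S (Q x)) h.eq
    simp only [mul_apply_eq_comp, hx, map_zero] at this
    exact this.symm
  have h2 := congrArg star h1
  simp only [star_mul, hQ.star_eq, hB.star_eq] at h2
  rw [Commute, SemiconjBy, ← h1, ← mul_assoc, h2]

theorem exists_isSelfAdjoint_exp_eq {U : K →L[ℂ] K} (hU : U ∈ unitary (K →L[ℂ] K)) :
    ∃ A : K →L[ℂ] K, IsSelfAdjoint A ∧ NormedSpace.exp (Complex.I • A) = U := by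
  have hn : IsStarNormal U := ⟨by
    rw [Commute, SemiconjBy, Unitary.star_mul_self_of_mem hU, Unitary.mul_star_self_of_mem hU]⟩
  have hspec : ∀ z ∈ spectrum ℂ U, z.re ^ 2 + z.im ^ 2 = 1 := by
    intro z hz
    have := spectrum.subset_circle_of_unitary hU hz
    rw [mem_sphere_zero_iff_norm] at this
    have h2 := Complex.sq_norm z
    rw [this, Complex.normSq_apply] at h2
    linarith
  -- On the circle, `b` is the absolute value of the argument, continuous even at `-1`; `p` and `n`
  -- are the positive and negative parts of `Im z`.
  let b : ℂ → ℂ := fun z => (Real.arccos z.re : ℂ)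
  let p : ℂ → ℂ := fun z => (max z.im 0 : ℝ)
  let n : ℂ → ℂ := fun z => (max (-z.im) 0 : ℝ)
  have hb : Continuous b :=
    Complex.continuous_ofReal.comp (Real.continuous_arccos.comp Complex.continuous_re)
  have hp : Continuous p := by fun_prop
  have hnc : Continuous n := by fun_prop
  have hreal : ∀ f : ℂ → ℝ, IsSelfAdjoint (cfc (fun z => (f z : ℂ)) U) := fun f => by
    rw [IsSelfAdjoint, ← cfc_star]
    simp
  set B := cfc b U with hBdef
  set N := cfc n U with hNdef
  set P := cfc p U with hPdef
  have hB : IsSelfAdjoint B := hreal _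
  have hP : IsSelfAdjoint P := hreal _
  set Q : K →L[ℂ] K := N.ker.starProjection with hQdef
  have hQ : IsSelfAdjoint Q := isSelfAdjoint_starProjection _
  have hQQ : Q * Q = Q := (Submodule.isIdempotentElem_starProjection N.ker).eq
  have hBQ : Commute B Q := commute_starProjection_ker hB (cfc_commute_cfc b n U)
  have hNQ : N * Q = 0 := by
    ext x
    exact Submodule.starProjection_apply_mem N.ker x
  have hNP : N * P = 0 := by
    rw [hNdef, hPdef, ← cfc_mul n p U hnc.continuousOn hp.continuousOn, ← cfc_zero ℂ U]
    refine cfc_congr fun z _ => ?_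
    simp only [n, p, ← Complex.ofReal_mul, Pi.zero_apply, Complex.ofReal_eq_zero]
    rcases le_total z.im 0 with h | h <;> simp [h]
  -- Since `NP = 0`, the range of `P` lies in `ker N`; the adjoint identity `PQ = P` says that `P`
  -- vanishes on the complement of `ker N`.
  have hQP : Q * P = P := by
    ext x
    refine Submodule.starProjection_eq_self_iff.2 ?_
    exact congrArg (fun S : K →L[ℂ] K => S x) hNP
  have hPQ : P * Q = P := by
    have := congrArg star hQP
    rwa [star_mul, hQ.star_eq, hP.star_eq] at this
  have hexp : ∀ s : ℂ, NormedSpace.exp (s • B) = cfc (fun z => Complex.exp (s * b z)) U := by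
    intro s
    have h1 : s • B = cfc (fun z => s * b z) U := (cfc_const_mul s b U hb.continuousOn).symm
    have h2 : IsStarNormal (s • B) := by rw [h1]; exact cfc_predicate _ U
    rw [← CFC.complex_exp_eq_normedSpace_exp h2, h1,
      ← cfc_comp' Complex.exp (fun z => s * b z) U (by fun_prop) (by fun_prop)]
  have hsin : ∀ z ∈ spectrum ℂ U, Complex.cos (b z) = z.re ∧ Complex.sin (b z) = (|z.im| : ℝ) := by
    intro z hz
    have h := hspec z hz
    have h1 : -1 ≤ z.re := by nlinarith [sq_nonneg z.im]
    have h2 : z.re ≤ 1 := by nlinarith [sq_nonneg z.im]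
    simp only [b, ← Complex.ofReal_cos, ← Complex.ofReal_sin]
    rw [Real.cos_arccos h1 h2, Real.sin_arccos, ← h, add_sub_cancel_left, Real.sqrt_sq_eq_abs]
    exact ⟨rfl, rfl⟩
  -- On the circle `e^{ib} = Re z + i|Im z|`, and `|Im z| = Im z + 2n = 2p - Im z`; the second form
  -- gives `hneg`.
  have hpos : NormedSpace.exp (Complex.I • B) = U + (2 * Complex.I) • N := by
    rw [hexp, hNdef, ← cfc_const_mul _ _ U hnc.continuousOn]
    nth_rewrite 2 [← cfc_id' ℂ U]
    rw [← cfc_add U _ _ (by fun_prop) (by fun_prop)]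
    refine cfc_congr fun z hz => ?_
    obtain ⟨h1, h2⟩ := hsin z hz
    simp only [mul_comm Complex.I, Complex.exp_mul_I, h1, h2, n]
    rcases le_total z.im 0 with h | h <;> apply Complex.ext <;>
      simp [h, abs_of_nonneg, abs_of_nonpos]
    ring
  have hneg : NormedSpace.exp ((-Complex.I) • B) = U - (2 * Complex.I) • P := by
    rw [hexp, hPdef, ← cfc_const_mul _ _ U hp.continuousOn]
    nth_rewrite 2 [← cfc_id' ℂ U]
    rw [← cfc_sub _ _ U (by fun_prop) (by fun_prop)]
    refine cfc_congr fun z hz => ?_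
    obtain ⟨h1, h2⟩ := hsin z hz
    simp only [neg_mul_comm]
    simp only [mul_comm Complex.I (-b z), Complex.exp_mul_I, Complex.cos_neg,
      Complex.sin_neg, h1, h2, p]
    rcases le_total z.im 0 with h | h <;> apply Complex.ext <;>
      simp [h, abs_of_nonneg, abs_of_nonpos]
    ring
  -- The angle is `B` on `ker N` and `-B` on its orthogonal complement.
  refine ⟨B * (Q - (1 - Q)), ?_, ?_⟩
  · rw [IsSelfAdjoint, star_mul, hB.star_eq, star_sub, star_sub, star_one, hQ.star_eq]
    simp only [mul_sub, sub_mul, hBQ.eq, one_mul, mul_one]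
  · have e1 : NormedSpace.exp (Complex.I • (B * (Q - (1 - Q)))) * Q
        = NormedSpace.exp (Complex.I • B) * Q := by
      refine exp_mul_eq_exp_mul_of_mul_eq ?_ (hBQ.smul_left _)
      simp only [smul_mul_assoc, mul_assoc, sub_mul, one_mul, hQQ, sub_self, sub_zero]
    have e2 : NormedSpace.exp (Complex.I • (B * (Q - (1 - Q)))) * (1 - Q)
        = NormedSpace.exp ((-Complex.I) • B) * (1 - Q) := by
      refine exp_mul_eq_exp_mul_of_mul_eq ?_
        (((Commute.one_right _).sub_right hBQ).smul_left _)
      have h : (Q - (1 - Q)) * (1 - Q) = -(1 - Q) := by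
        simp only [mul_sub, sub_mul, mul_one, one_mul, hQQ]
        abel
      rw [smul_mul_assoc, smul_mul_assoc, mul_assoc, h, mul_neg, smul_neg, neg_smul]
    have key := congrArg₂ (· + ·) e1 e2
    simp only [← mul_add, add_sub_cancel, mul_one] at key
    -- The error terms `NQ` and `P(1 - Q)` both vanish, leaving `UQ + U(1 - Q) = U`.
    rw [key, hpos, hneg]
    simp only [add_mul, sub_mul, mul_sub, mul_one, smul_mul_assoc, hNQ, hPQ, smul_zero]
    abel

end Hilbert


/-! ### The Hilbert space of the Nagy product -/

section NagySpace

variable {H : Type*} [NormedAddCommGroup H] [InnerProductSpace ℂ H]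

/-- The space `H` with the Nagy product of `T` as its inner product. -/
@[nolint unusedArguments]
def NagySpace (_ : BanachLimit) (T : H ≃L[ℂ] H) (_ : UniformlyBounded T) : Type _ := H

namespace NagySpace

variable (L : BanachLimit) (T : H ≃L[ℂ] H) (hT : UniformlyBounded T)

instance : AddCommGroup (NagySpace L T hT) := inferInstanceAs (AddCommGroup H)

instance : Module ℂ (NagySpace L T hT) := inferInstanceAs (Module ℂ H)

/-- The Nagy product as an inner product core on `NagySpace`. -/
@[reducible] noncomputable def core : InnerProductSpace.Core ℂ (NagySpace L T hT) where
  inner := nagyProduct (H := H) L T hT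
  conj_inner_symm := (nagyProductCore (H := H) L T hT).conj_inner_symm
  re_inner_nonneg := (nagyProductCore (H := H) L T hT).re_inner_nonneg
  add_left := (nagyProductCore (H := H) L T hT).add_left
  smul_left := (nagyProductCore (H := H) L T hT).smul_left
  definite := (nagyProductCore (H := H) L T hT).definite

noncomputable instance : NormedAddCommGroup (NagySpace L T hT) :=
  (core L T hT).toNormedAddCommGroup

noncomputable instance : InnerProductSpace ℂ (NagySpace L T hT) :=
  .ofCore (core L T hT).toCore

noncomputable instance : Inner ℂ (NagySpace L T hT) := InnerProductSpace.toInner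

/-- The identity as a linear map from `H` to `H` with the Nagy product. -/
def linearEquiv : H ≃ₗ[ℂ] NagySpace L T hT where
  toFun x := x
  invFun x := x
  map_add' _ _ := rfl
  map_smul' _ _ := rfl

theorem inner_linearEquiv (x y : H) :
    inner ℂ (linearEquiv L T hT x) (linearEquiv L T hT y) = nagyProduct L T hT x y := rfl

theorem exists_norm_linearEquiv_le :
    ∃ c : ℝ, ∀ x, ‖linearEquiv L T hT x‖ ≤ c * ‖x‖ := by
  obtain ⟨b, hb, h⟩ := lim_nagySeq_self_le L T hT
  refine ⟨√b, fun x => ?_⟩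
  have h1 := h x
  change nagyProduct L T hT x x ≤ _ at h1
  rw [← inner_linearEquiv, inner_self_eq_norm_sq_to_K] at h1
  have h2 : ‖linearEquiv L T hT x‖ ^ 2 ≤ b * ‖x‖ ^ 2 :=
    Complex.real_le_real.1 (by rwa [Complex.ofReal_pow])
  refine (sq_le_sq₀ (norm_nonneg _) (by positivity)).1 ?_
  rwa [mul_pow, Real.sq_sqrt hb.le]

theorem exists_norm_linearEquiv_symm_le :
    ∃ c : ℝ, ∀ x, ‖(linearEquiv L T hT).symm x‖ ≤ c * ‖x‖ := by
  obtain ⟨a, ha, h⟩ := lim_nagySeq_self_ge L T hT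
  refine ⟨(√a)⁻¹, fun x => ?_⟩
  have h1 := h ((linearEquiv L T hT).symm x)
  change _ ≤ nagyProduct L T hT _ _ at h1
  rw [← inner_linearEquiv, LinearEquiv.apply_symm_apply, inner_self_eq_norm_sq_to_K] at h1
  have h2 : a * ‖(linearEquiv L T hT).symm x‖ ^ 2 ≤ ‖x‖ ^ 2 :=
    Complex.real_le_real.1 (by rwa [Complex.ofReal_pow])
  rw [le_inv_mul_iff₀ (Real.sqrt_pos.2 ha)]
  refine (sq_le_sq₀ (by positivity) (norm_nonneg _)).1 ?_
  rwa [mul_pow, Real.sq_sqrt ha.le]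

/-- The identity from `H` to `H` with the Nagy product is a homeomorphism. -/
noncomputable def equiv : H ≃L[ℂ] NagySpace L T hT :=
  (linearEquiv L T hT).toContinuousLinearEquivOfBounds _ _
    (exists_norm_linearEquiv_le L T hT).choose_spec
    (exists_norm_linearEquiv_symm_le L T hT).choose_spec

instance [CompleteSpace H] : CompleteSpace (NagySpace L T hT) :=
  (completeSpace_congr (e := (equiv L T hT).toEquiv)
    (equiv L T hT).isUniformEmbedding).1 inferInstance

end NagySpace

/-- The sequence for `(T x, T y)` is the shift of the one for `(x, y)`. -/
theorem nagyProduct_map_map (L : BanachLimit) (T : H ≃L[ℂ] H) (hT : UniformlyBounded T)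
    (x y : H) : nagyProduct L T hT (T x) (T y) = nagyProduct L T hT x y :=
  L.lim_shift (nagySeq T hT x y)

end NagySpace

/-! ### The one-parameter group `e^{iAt}` -/

section ExpI

variable {H : Type*} [NormedAddCommGroup H] [InnerProductSpace ℂ H]

theorem expI_zero (A : H →L[ℂ] H) : expI A 0 = 1 := by simp [expI]

variable [CompleteSpace H]

theorem expI_add (A : H →L[ℂ] H) (s t : ℝ) : expI A (s + t) = expI A s * expI A t := by
  let +nondep : NormedAlgebra ℚ (H →L[ℂ] H) := .restrictScalars ℚ ℂ _
  rw [expI, expI, expI, ← NormedSpace.exp_add_of_commute, ← add_smul]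
  · push_cast
    ring_nf
  · exact ((Commute.refl A).smul_left _).smul_right _

theorem hasDerivAt_expI (A : H →L[ℂ] H) (t : ℝ) :
    HasDerivAt (expI A) ((Complex.I • A) * expI A t) t := by
  have h := hasDerivAt_exp_smul_const' (𝕂 := ℝ) (Complex.I • A) t
  have h1 : ∀ s : ℝ, s • Complex.I • A = (Complex.I * (s : ℂ)) • A := fun s => by
    rw [mul_comm, mul_smul, Complex.coe_smul]
  simp only [h1] at h
  exact h

theorem IsSelfAdjoint.inner_expI_expI {A : H →L[ℂ] H} (hA : IsSelfAdjoint A) (t : ℝ) (x y : H) :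
    inner ℂ (expI A t x) (expI A t y) = inner ℂ x y := by
  -- For self-adjoint `A` the adjoint of `e^{iAt}` is `e^{-iAt}`, so the group law applies.
  have h : star (expI A t) * expI A t = 1 := by
    rw [expI, NormedSpace.star_exp, star_smul, hA.star_eq]
    have := expI_add A (-t) t
    rw [neg_add_cancel, expI_zero] at this
    rw [this, expI, expI]
    simp
  rw [← ContinuousLinearMap.adjoint_inner_right]
  exact congrArg (fun S : H →L[ℂ] H => inner ℂ x (S y)) h

theorem coe_zpow_eq_expI {A : H →L[ℂ] H} {T : H ≃L[ℂ] H} (h : (T : H →L[ℂ] H) = expI A 1)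
    (n : ℤ) : ((T ^ n : H ≃L[ℂ] H) : H →L[ℂ] H) = expI A n := by
  have hsymm : ((T⁻¹ : H ≃L[ℂ] H) : H →L[ℂ] H) = expI A (-1) := by
    have h1 : expI A 1 * expI A (-1) = 1 := by rw [← expI_add, add_neg_cancel, expI_zero]
    have h2 : ((T⁻¹ : H ≃L[ℂ] H) : H →L[ℂ] H) * (T : H →L[ℂ] H) = 1 := by
      ext x
      exact T.symm_apply_apply x
    rw [h] at h2
    exact left_inv_eq_right_inv h2 h1
  induction n with
  | zero => simpa using (expI_zero A).symm
  | succ n ih =>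
    rw [zpow_add_one]
    change ((T ^ (n : ℤ) : H ≃L[ℂ] H) : H →L[ℂ] H) * (T : H →L[ℂ] H) = _
    rw [ih, h, ← expI_add]
    push_cast
    rfl
  | pred n ih =>
    rw [zpow_sub_one]
    change ((T ^ (-n : ℤ) : H ≃L[ℂ] H) : H →L[ℂ] H) * ((T⁻¹ : H ≃L[ℂ] H) : H →L[ℂ] H) = _
    rw [ih, hsymm, ← expI_add]
    push_cast
    rfl

theorem expI_conj {K : Type*} [NormedAddCommGroup K] [InnerProductSpace ℂ K] [CompleteSpace K]
    (e : K ≃L[ℂ] H) (A : K →L[ℂ] K) (t : ℝ) :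
    expI (e.conjContinuousAlgEquiv A) t = e.conjContinuousAlgEquiv (expI A t) := by
  let +nondep : NormedAlgebra ℚ (H →L[ℂ] H) := .restrictScalars ℚ ℂ _
  let +nondep : NormedAlgebra ℚ (K →L[ℂ] K) := .restrictScalars ℚ ℂ _
  rw [expI, expI, NormedSpace.map_exp e.conjContinuousAlgEquiv
    e.conjContinuousAlgEquiv.continuous, map_smul]

end ExpI

/-! ### Transfer of the logarithm back to the original space -/

theorem mem_unitary_of_inner_map_map {K : Type*} [NormedAddCommGroup K] [InnerProductSpace ℂ K]
    [CompleteSpace K] (U : K ≃L[ℂ] K) (h : ∀ x y, inner ℂ (U x) (U y) = inner ℂ x y) :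
    (U : K →L[ℂ] K) ∈ unitary (K →L[ℂ] K) := by
  have h1 : star (U : K →L[ℂ] K) * U = 1 :=
    (ContinuousLinearMap.inner_map_map_iff_adjoint_comp_self _).1 h
  have h2 : (U : K →L[ℂ] K) * (U.symm : K →L[ℂ] K) = 1 := by
    ext x
    exact U.apply_symm_apply x
  refine Unitary.mem_iff.2 ⟨h1, ?_⟩
  rw [left_inv_eq_right_inv h1 h2, h2]


theorem hasDerivAt_expI_apply {H : Type*} [NormedAddCommGroup H] [InnerProductSpace ℂ H]
    [CompleteSpace H] (A : H →L[ℂ] H) (t : ℝ) (ψ : H) :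
    HasDerivAt (fun s : ℝ => expI A s ψ) (Complex.I • A (expI A t ψ)) t := by
  -- Evaluation at `ψ` is taken real-linear because the time variable is real.
  let evalAt : (H →L[ℂ] H) →L[ℝ] H := (ContinuousLinearMap.apply ℂ H ψ).restrictScalars ℝ
  exact evalAt.hasFDerivAt.comp_hasDerivAt t (hasDerivAt_expI A t)

/-- An automorphism `T` that becomes unitary under an isomorphism `e` onto a Hilbert space is
`e^{iA}` for a bounded `A` that becomes self-adjoint under `e`. -/
theorem exists_expI_eq_of_inner_map_map {H K : Type*} [NormedAddCommGroup H]
    [InnerProductSpace ℂ H] [CompleteSpace H] [NormedAddCommGroup K] [InnerProductSpace ℂ K]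
    [CompleteSpace K] (e : H ≃L[ℂ] K) (T : H ≃L[ℂ] H)
    (hT : ∀ x y, inner ℂ (e (T x)) (e (T y)) = inner ℂ (e x) (e y)) :
    ∃ A : H →L[ℂ] H,
      (∀ x y, inner ℂ (e (A x)) (e y) = inner ℂ (e x) (e (A y))) ∧
      (T : H →L[ℂ] H) = expI A 1 ∧
      ∀ (t : ℝ) (x y : H), inner ℂ (e (expI A t x)) (e (expI A t y)) = inner ℂ (e x) (e y) := by
  -- The conjugate `e T e⁻¹` is unitary on `K`; its logarithm is conjugated back by `e`.
  obtain ⟨A, hA, hexp⟩ := exists_isSelfAdjoint_exp_eq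
    (mem_unitary_of_inner_map_map ((e.symm.trans T).trans e) fun x y => by
      simpa using hT (e.symm x) (e.symm y))
  refine ⟨e.symm.conjContinuousAlgEquiv A, fun x y => ?_, ?_, fun t x y => ?_⟩
  · have h := ContinuousLinearMap.isSelfAdjoint_iff_isSymmetric.1 hA (e x) (e y)
    simpa using h
  · rw [expI_conj, expI, Complex.ofReal_one, mul_one, hexp]
    ext x
    simp
  · rw [expI_conj]
    simpa using hA.inner_expI_expI t (e x) (e y)

theorem proposition4 {H : Type*} [NormedAddCommGroup H] [InnerProductSpace ℂ H] [CompleteSpace H]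
    (T : H ≃L[ℂ] H) (hT : UniformlyBounded T) (L : BanachLimit) :
    ∃ A : H →L[ℂ] H,
      -- `A` is self-adjoint for the Nagy product `h_T`
      (∀ x y : H, nagyProduct L T hT (A x) y = nagyProduct L T hT x (A y)) ∧
      -- `T ^ n = e^{iAn}` for every integer `n`
      (∀ n : ℤ, ((T ^ n : H ≃L[ℂ] H) : H →L[ℂ] H) = expI A (n : ℝ)) ∧
      -- `t ↦ e^{iAt}` is a continuous one-parameter group ...
      expI A 0 = 1 ∧
      (∀ s t : ℝ, expI A (s + t) = expI A s * expI A t) ∧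
      Continuous (fun t : ℝ => expI A t) ∧
      -- ... of `h_T`-unitary operators (invertible by the group law) ...
      (∀ (t : ℝ) (x y : H), nagyProduct L T hT (expI A t x) (expI A t y) =
        nagyProduct L T hT x y) ∧
      -- ... whose orbits are differentiable solutions of `dψ/dt = i A ψ`
      (∀ (t : ℝ) (ψ : H), HasDerivAt (fun s : ℝ => expI A s ψ)
        (Complex.I • A (expI A t ψ)) t) := by
  obtain ⟨A, hA, hTA, hunit⟩ := exists_expI_eq_of_inner_map_map (NagySpace.equiv L T hT) T
    (nagyProduct_map_map L T hT)
  exact ⟨A, hA, coe_zpow_eq_expI hTA, expI_zero A, expI_add A,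
    continuous_iff_continuousAt.2 fun t => (hasDerivAt_expI A t).continuousAt, hunit,
    fun t ψ => hasDerivAt_expI_apply A t ψ⟩
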